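/- Let $(X,\Sigma,\mu)$ be a probability space, let $T_1,\dots,T_d : X\to X$ be pairwise commuting invertible bimeasurable maps that preserve $\mu$, and let $f_1,\dots,f_d\in L^\infty(\mu)$ be complex-valued. Then the multiple ergodic averages over long intervals of integers converge in norm: there is a function $F\in L^2(\mu)$ such that, for every sequence $(I_N)_{N\ge 1}$ of finite intervals $I_N\subset\mathbb{Z}$ with $|I_N|\to\infty$, \[\frac{1}{|I_N|}\sum_{n\in I_N}\ \prod_{i=1}^{d} f_i\circ T_i^{\,n}\ \longrightarrow\ F\qquad\text{in } L^2(\mu)\text{ as } N\to\infty .\] In particular (taking $I_N=\{1,\dots,N\}$), the averages $\frac1N\sum_{n=1}^N\prod_{i=1}^d f_i\circ T_i^{\,n}$ converge in $L^2(\mu)$. -/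

import Mathlib

open MeasureTheory Filter Topology
open scoped ENNReal

/-- The multiple ergodic average over a finite set `I` of integers,
`x ↦ (1 / |I|) ∑ n ∈ I, ∏ i, f i (T i ^ n x)`. The integer powers are those of the group of
bijections of `X`, so that `T i ^ n` is the `n`-fold composition, with the inverse map for
negative `n`. -/
noncomputable def multipleErgodicAverage {X : Type*} [MeasurableSpace X] {d : ℕ}
    (T : Fin d → X ≃ᵐ X) (f : Fin d → X → ℂ) (I : Finset ℤ) (x : X) : ℂ :=
  (I.card : ℂ)⁻¹ * ∑ n ∈ I, ∏ i, f i ((((T i).toEquiv : Equiv.Perm X) ^ n) x)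

/-! ### Averages over long intervals of integers -/

section Averages

variable {E F : Type*} [AddCommGroup E] [Module ℂ E] [AddCommGroup F] [Module ℂ F]

/-! The proof is an induction on the number of transformations, for all systems `InvariantState` at
once and along `longIntervals`, hence uniformly in the left end points; this makes the limit
independent of the chosen intervals.

Let `t` be the last group element and let `A_p x` be the average over `j` of `(∏ T_i^j f_i) · t^j x`
(`avgOp`). The vectors `x` with Cauchy averages form a closed subspace, so it suffices that `A_p u →
0` for `u` orthogonal to it: such a `u` then also lies in the subspace and vanishes. For a bounded
`v` close to `u`, `‖A_p u‖²` is close to `⟨A_p v, A_p u⟩ = ⟨A_p^* (A_p v), u⟩`, so it is enough that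
every weak limit `σ` of vectors `A_p^* g_p`, with `g_p` uniformly bounded, lies in the subspace.

In `(∏ T_i^j f_i) · t^j σ` the substitution `k → k + j` inside the adjoint average absorbs `t^j` and
leaves the coefficients `∏ T_i^j (f_i · t^(-k) T_i^k f_i^*)` (`tendsto_mulOp_actOp_dualAvg_sub`). As
sequences in `k` these are orbit products without `t` in the system `sequenceState` on `ℤ →ᵇ A`.
There the averages are Cauchy by induction, and Cauchy–Schwarz carries this over to `σ`
(`norm_avgOp_sub_le_of_weak_limit`). Since this extension is built from an ultrafilter limit, the
induction runs over algebras with a state instead of measure spaces. -/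

/-- The average of `x` over the interval `[p.1, p.1 + p.2)` of integers. -/
noncomputable def intervalAvg (p : ℤ × ℕ) (x : ℤ → E) : E :=
  (p.2 : ℂ)⁻¹ • ∑ k ∈ Finset.range p.2, x (p.1 + k)

/-- The filter of intervals (given by left end point and length) whose length tends to infinity. -/
def longIntervals : Filter (ℤ × ℕ) := ⊤ ×ˢ atTop

instance : longIntervals.NeBot := by unfold longIntervals; infer_instance

lemma tendsto_snd_longIntervals : Tendsto Prod.snd longIntervals atTop := tendsto_snd

lemma map_intervalAvg {Φ : Type*} [FunLike Φ E F] [LinearMapClass Φ ℂ E F] (φ : Φ) (p : ℤ × ℕ)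
    (x : ℤ → E) : φ (intervalAvg p x) = intervalAvg p (fun k => φ (x k)) := by
  simp [intervalAvg, map_smul, map_sum]

lemma intervalAvg_add (p : ℤ × ℕ) (x y : ℤ → E) :
    intervalAvg p (fun k => x k + y k) = intervalAvg p x + intervalAvg p y := by
  simp [intervalAvg, Finset.sum_add_distrib]

lemma intervalAvg_sub (p : ℤ × ℕ) (x y : ℤ → E) :
    intervalAvg p (fun k => x k - y k) = intervalAvg p x - intervalAvg p y := by
  simp [intervalAvg, Finset.sum_sub_distrib, smul_sub]

lemma intervalAvg_smul (p : ℤ × ℕ) (c : ℂ) (x : ℤ → E) :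
    intervalAvg p (fun k => c • x k) = c • intervalAvg p x := by
  simp only [intervalAvg, ← Finset.smul_sum]
  rw [smul_comm]

lemma intervalAvg_comm (p q : ℤ × ℕ) (x : ℤ → ℤ → E) :
    intervalAvg p (fun j => intervalAvg q (fun k => x j k)) =
      intervalAvg q (fun k => intervalAvg p (fun j => x j k)) := by
  simp only [intervalAvg, ← Finset.smul_sum]
  rw [smul_comm, Finset.sum_comm]

lemma intervalAvg_const (p : ℤ × ℕ) (hp : p.2 ≠ 0) (x : E) : intervalAvg p (fun _ => x) = x := by
  have : (p.2 : ℂ) ≠ 0 := by exact_mod_cast hp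
  simp [intervalAvg, ← Nat.cast_smul_eq_nsmul ℂ, smul_smul, this]

lemma re_intervalAvg (p : ℤ × ℕ) (x : ℤ → ℂ) :
    (intervalAvg p x).re = (p.2 : ℝ)⁻¹ * ∑ k ∈ Finset.range p.2, (x (p.1 + k)).re := by
  have : ((p.2 : ℂ)⁻¹) = (((p.2 : ℝ)⁻¹ : ℝ) : ℂ) := by push_cast; rfl
  rw [intervalAvg, smul_eq_mul, this, Complex.re_ofReal_mul, Complex.re_sum]

end Averages

section NormedAverages

variable {E : Type*} [SeminormedAddCommGroup E] [NormedSpace ℂ E]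

lemma norm_intervalAvg_le_sum (p : ℤ × ℕ) (x : ℤ → E) :
    ‖intervalAvg p x‖ ≤ (p.2 : ℝ)⁻¹ * ∑ k ∈ Finset.range p.2, ‖x (p.1 + k)‖ := by
  rw [intervalAvg, norm_smul]
  simp only [norm_inv, RCLike.norm_natCast]
  gcongr
  exact norm_sum_le _ _

lemma norm_intervalAvg_le (p : ℤ × ℕ) {x : ℤ → E} {C : ℝ} (hC : 0 ≤ C) (hx : ∀ k, ‖x k‖ ≤ C) :
    ‖intervalAvg p x‖ ≤ C := by
  refine (norm_intervalAvg_le_sum p x).trans ?_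
  calc (p.2 : ℝ)⁻¹ * ∑ k ∈ Finset.range p.2, ‖x (p.1 + k)‖
      ≤ (p.2 : ℝ)⁻¹ * ∑ k ∈ Finset.range p.2, C := by gcongr; exact hx _
    _ = ((p.2 : ℝ)⁻¹ * p.2) * C := by simp [mul_assoc]
    _ ≤ 1 * C := by gcongr; exact inv_mul_le_one
    _ = C := one_mul C

lemma norm_intervalAvg_sq_le (p : ℤ × ℕ) (x : ℤ → E) :
    ‖intervalAvg p x‖ ^ 2 ≤ (p.2 : ℝ)⁻¹ * ∑ k ∈ Finset.range p.2, ‖x (p.1 + k)‖ ^ 2 := by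
  rcases Nat.eq_zero_or_pos p.2 with h | h
  · simp [intervalAvg, h]
  have h' : (0 : ℝ) < p.2 := by exact_mod_cast h
  calc ‖intervalAvg p x‖ ^ 2
      ≤ ((p.2 : ℝ)⁻¹ * ∑ k ∈ Finset.range p.2, ‖x (p.1 + k)‖) ^ 2 := by
        gcongr; exact norm_intervalAvg_le_sum p x
    _ = (p.2 : ℝ)⁻¹ ^ 2 * (∑ k ∈ Finset.range p.2, ‖x (p.1 + k)‖) ^ 2 := mul_pow _ _ _
    _ ≤ (p.2 : ℝ)⁻¹ ^ 2 * (p.2 * ∑ k ∈ Finset.range p.2, ‖x (p.1 + k)‖ ^ 2) := by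
        gcongr
        simpa using sq_sum_le_card_mul_sum_sq (s := Finset.range p.2)
          (f := fun k : ℕ => ‖x (p.1 + k)‖)
    _ = (p.2 : ℝ)⁻¹ * ∑ k ∈ Finset.range p.2, ‖x (p.1 + k)‖ ^ 2 := by
        field_simp

/-- The difference telescopes to the two end terms. -/
lemma norm_intervalAvg_sub_shift_one_le (p : ℤ × ℕ) {x : ℤ → E} {C : ℝ} (hx : ∀ k, ‖x k‖ ≤ C) :
    ‖intervalAvg p x - intervalAvg p (fun k => x (k + 1))‖ ≤ 2 * C / p.2 := by
  have h : intervalAvg p x - intervalAvg p (fun k => x (k + 1)) =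
      -((p.2 : ℂ)⁻¹ • (x (p.1 + p.2) - x p.1)) := by
    have := Finset.sum_range_sub (fun k : ℕ => x (p.1 + k)) p.2
    simp only [Nat.cast_zero, add_zero] at this
    rw [← this]
    simp only [intervalAvg, ← smul_sub, Finset.sum_sub_distrib, ← smul_neg, neg_sub]
    simp only [Nat.cast_add, Nat.cast_one, add_assoc]
  rw [h, norm_neg, norm_smul, norm_inv, RCLike.norm_natCast, div_eq_inv_mul]
  gcongr
  calc _ ≤ ‖x (p.1 + p.2)‖ + ‖x p.1‖ := norm_sub_le _ _
    _ ≤ 2 * C := by linarith [hx (p.1 + p.2), hx p.1]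

lemma norm_intervalAvg_sub_shift_nat_le (p : ℤ × ℕ) {x : ℤ → E} {C : ℝ} (hx : ∀ k, ‖x k‖ ≤ C)
    (j : ℕ) : ‖intervalAvg p x - intervalAvg p (fun k => x (k + j))‖ ≤ j * (2 * C / p.2) := by
  induction j with
  | zero => simp
  | succ j ih =>
    have h := norm_intervalAvg_sub_shift_one_le p (x := fun k => x (k + j)) (fun k => hx _)
    have e : (fun k : ℤ => x (k + 1 + j)) = fun k => x (k + ((j + 1 : ℕ) : ℤ)) := by
      funext k; congr 1; push_cast; ring
    rw [e] at h
    calc _ ≤ _ := norm_sub_le_norm_sub_add_norm_sub _ (intervalAvg p (fun k => x (k + j))) _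
      _ ≤ j * (2 * C / p.2) + 2 * C / p.2 := add_le_add ih h
      _ = _ := by push_cast; ring

lemma norm_intervalAvg_sub_shift_le (p : ℤ × ℕ) {x : ℤ → E} {C : ℝ} (hx : ∀ k, ‖x k‖ ≤ C)
    (j : ℤ) : ‖intervalAvg p x - intervalAvg p (fun k => x (k + j))‖ ≤
      j.natAbs * (2 * C / p.2) := by
  obtain ⟨n, rfl | rfl⟩ := j.eq_nat_or_neg
  · simpa using norm_intervalAvg_sub_shift_nat_le p hx n
  -- A negative shift is undone by a positive shift of the already shifted sequence.
  · have := norm_intervalAvg_sub_shift_nat_le p (x := fun k => x (k + -n)) (fun k => hx _) n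
    rw [norm_sub_rev]
    simpa using this

/-- Averages over long intervals of uniformly bounded families are asymptotically
translation invariant. -/
lemma tendsto_intervalAvg_sub_shift {x : ℤ × ℕ → ℤ → E} {C : ℝ} (hx : ∀ p k, ‖x p k‖ ≤ C)
    (j : ℤ) : Tendsto (fun p => intervalAvg p (x p) - intervalAvg p (fun k => x p (k + j)))
      longIntervals (𝓝 0) := by
  refine squeeze_zero_norm (fun p => norm_intervalAvg_sub_shift_le p (hx p) j) ?_
  have : Tendsto (fun p : ℤ × ℕ => (j.natAbs : ℝ) * (2 * C / (p.2 : ℝ))) longIntervals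
      (𝓝 (j.natAbs * 0)) :=
    Tendsto.const_mul _ (Tendsto.div_atTop tendsto_const_nhds
      (tendsto_natCast_atTop_atTop.comp tendsto_snd_longIntervals))
  simpa using this

end NormedAverages

/-! ### Limits along ultrafilters -/

section UltrafilterLimits

variable {ι : Type*} (U : Ultrafilter ι)

lemma Ultrafilter.exists_tendsto_of_norm_le {f : ι → ℂ} {C : ℝ} (hf : ∀ i, ‖f i‖ ≤ C) :
    ∃ z, Tendsto f U (𝓝 z) := by
  obtain ⟨z, -, hz⟩ := (isCompact_closedBall (0 : ℂ) C).ultrafilter_le_nhds (U.map f) (by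
    rw [le_principal_iff]
    exact Filter.mem_map.2 (Filter.univ_mem' fun i => by simpa using hf i))
  exact ⟨z, hz⟩

lemma Ultrafilter.tendsto_limUnder {f : ι → ℂ} {C : ℝ} (hf : ∀ i, ‖f i‖ ≤ C) :
    Tendsto f U (𝓝 (limUnder (U : Filter ι) f)) :=
  tendsto_nhds_limUnder (U.exists_tendsto_of_norm_le hf)

end UltrafilterLimits

section WeakLimits

open scoped InnerProductSpace

variable {ι H : Type*} [NormedAddCommGroup H] [InnerProductSpace ℂ H] [CompleteSpace H]

/-- Bounded families in a Hilbert space have weak limits along ultrafilters. -/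
lemma Ultrafilter.exists_weak_limit (U : Ultrafilter ι) {σ : ι → H} {C : ℝ}
    (hσ : ∀ i, ‖σ i‖ ≤ C) : ∃ s : H, ∀ x, Tendsto (fun i => ⟪σ i, x⟫_ℂ) U (𝓝 ⟪s, x⟫_ℂ) := by
  have hb (x : H) (i : ι) : ‖⟪σ i, x⟫_ℂ‖ ≤ C * ‖x‖ :=
    (norm_inner_le_norm _ _).trans (by gcongr; exact hσ i)
  let ℓ : H →ₗ[ℂ] ℂ :=
    { toFun := fun x => limUnder (U : Filter ι) fun i => ⟪σ i, x⟫_ℂ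
      map_add' := fun x y => by
        refine Tendsto.limUnder_eq ?_
        simpa [inner_add_right] using
          (U.tendsto_limUnder (hb x)).add (U.tendsto_limUnder (hb y))
      map_smul' := fun c x => by
        refine Tendsto.limUnder_eq ?_
        simpa [inner_smul_right] using (U.tendsto_limUnder (hb x)).const_mul c }
  have hℓ (x : H) : ‖ℓ x‖ ≤ C * ‖x‖ :=
    le_of_tendsto (U.tendsto_limUnder (hb x)).norm (Eventually.of_forall (hb x))
  refine ⟨(InnerProductSpace.toDual ℂ H).symm (ℓ.mkContinuous C hℓ), fun x => ?_⟩
  rw [InnerProductSpace.toDual_symm_apply]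
  exact U.tendsto_limUnder (hb x)

end WeakLimits

/-! ### Invariant states and their Hilbert spaces -/

open scoped InnerProductSpace

/-- A positive bounded functional on a commutative normed `*`-algebra `A`, invariant under an
action of a group `G` by contractive `*`-endomorphisms: an algebraic version of a
measure-preserving system, `A` playing the role of the bounded functions. -/
structure InvariantState (G A : Type*) [Group G] [NormedCommRing A] [NormedAlgebra ℂ A]
    [StarRing A] where
  /-- The functional, which plays the role of the integral. -/
  state : A →ₗ[ℂ] ℂ
  /-- The action of the group. -/
  act : G →* (A →⋆ₐ[ℂ] A)
  norm_act_le : ∀ g a, ‖act g a‖ ≤ ‖a‖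
  norm_state_le : ∀ a, ‖state a‖ ≤ ‖a‖
  state_act : ∀ g a, state (act g a) = state a
  state_star : ∀ a, state (star a) = star (state a)
  state_nonneg : ∀ a, 0 ≤ (state (star a * a)).re
  -- This is what makes multiplication by `a` a bounded operator on the Hilbert space.
  state_mul_le : ∀ a b,
    (state (star (a * b) * (a * b))).re ≤ ‖a‖ ^ 2 * (state (star b * b)).re

namespace InvariantState

variable {G A : Type*} [Group G] [NormedCommRing A] [NormedAlgebra ℂ A] [StarRing A]
  (S : InvariantState G A)

lemma act_inv_act (g : G) (a : A) : S.act g⁻¹ (S.act g a) = a := by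
  have : (S.act g⁻¹ * S.act g) a = a := by rw [← map_mul, inv_mul_cancel, map_one]; rfl
  exact this

lemma act_act (g h : G) (a : A) : S.act g (S.act h a) = S.act (g * h) a := by
  rw [map_mul]; rfl

variable [StarModule ℂ A]

/-- The algebra with the seminorm given by the functional. -/
@[nolint unusedArguments]
def PreL2 (_ : InvariantState G A) := A

instance : AddCommGroup S.PreL2 := inferInstanceAs (AddCommGroup A)
instance : Module ℂ S.PreL2 := inferInstanceAs (Module ℂ A)

/-- The identification of the algebra with the pre-Hilbert space. -/
noncomputable def toPre : A ≃ₗ[ℂ] S.PreL2 := LinearEquiv.refl ℂ _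

/-- The pre-inner product given by the functional. -/
noncomputable abbrev preCore : PreInnerProductSpace.Core ℂ S.PreL2 where
  inner a b := S.state (star (S.toPre.symm a) * S.toPre.symm b)
  conj_inner_symm a b := by
    rw [starRingEnd_apply, ← S.state_star]
    simp [mul_comm]
  re_inner_nonneg a := S.state_nonneg _
  add_left _ _ _ := by rw [map_add, star_add, add_mul, map_add]
  smul_left _ _ _ := by simp

noncomputable instance : SeminormedAddCommGroup S.PreL2 :=
  InnerProductSpace.Core.toSeminormedAddCommGroup (c := S.preCore)
noncomputable instance : InnerProductSpace ℂ S.PreL2 :=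
  InnerProductSpace.ofCore S.preCore

lemma inner_toPre (a b : A) : ⟪S.toPre a, S.toPre b⟫_ℂ = S.state (star a * b) := rfl

lemma norm_sq_toPre (a : A) : ‖S.toPre a‖ ^ 2 = (S.state (star a * a)).re := by
  rw [← inner_toPre, ← inner_self_eq_norm_sq (𝕜 := ℂ)]
  rfl

/-- The Hilbert space of the functional. -/
abbrev L2 := UniformSpace.Completion S.PreL2

/-- The canonical map from the algebra to the Hilbert space. -/
noncomputable def toL2 : A →ₗ[ℂ] S.L2 :=
  (UniformSpace.Completion.toComplL (𝕜 := ℂ) (E := S.PreL2)).toLinearMap ∘ₗ S.toPre.toLinearMap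

lemma toL2_apply (a : A) : S.toL2 a = ((S.toPre a : S.PreL2) : S.L2) := rfl

lemma inner_toL2 (a b : A) : ⟪S.toL2 a, S.toL2 b⟫_ℂ = S.state (star a * b) := by
  rw [toL2_apply, toL2_apply, UniformSpace.Completion.inner_coe, inner_toPre]

lemma norm_sq_toL2 (a : A) : ‖S.toL2 a‖ ^ 2 = (S.state (star a * a)).re := by
  rw [toL2_apply, UniformSpace.Completion.norm_coe, norm_sq_toPre]

lemma denseRange_toL2 : DenseRange S.toL2 :=
  UniformSpace.Completion.denseRange_coe (α := S.PreL2)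

lemma induction_toL2 {p : S.L2 → Prop} (hp : IsClosed {x | p x}) (h : ∀ a, p (S.toL2 a))
    (x : S.L2) : p x :=
  UniformSpace.Completion.induction_on x hp fun a => h (S.toPre.symm a)

lemma norm_toL2_mul_le (a b : A) : ‖S.toL2 (a * b)‖ ≤ ‖a‖ * ‖S.toL2 b‖ := by
  rw [← sq_le_sq₀ (by positivity) (by positivity), mul_pow, norm_sq_toL2, norm_sq_toL2]
  exact S.state_mul_le a b

lemma norm_toL2_act (g : G) (a : A) : ‖S.toL2 (S.act g a)‖ = ‖S.toL2 a‖ := by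
  rw [← sq_eq_sq₀ (by positivity) (by positivity), norm_sq_toL2, norm_sq_toL2, ← map_star,
    ← map_mul, S.state_act]

/-- Multiplication by an element of the algebra on the Hilbert space. -/
noncomputable def mulOp (a : A) : S.L2 →L[ℂ] S.L2 :=
  ((S.toPre.toLinearMap ∘ₗ LinearMap.mulLeft ℂ a ∘ₗ S.toPre.symm.toLinearMap).mkContinuous ‖a‖
    fun x => by
      have := S.norm_toL2_mul_le a (S.toPre.symm x)
      rw [toL2_apply, toL2_apply, UniformSpace.Completion.norm_coe,
        UniformSpace.Completion.norm_coe] at this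
      exact this).completion

/-- The action of the group on the Hilbert space. -/
noncomputable def actOp (g : G) : S.L2 →L[ℂ] S.L2 :=
  ((S.toPre.toLinearMap ∘ₗ ((S.act g : A →ₐ[ℂ] A) : A →ₗ[ℂ] A) ∘ₗ
    S.toPre.symm.toLinearMap).mkContinuous 1 fun x => by
      have := (S.norm_toL2_act g (S.toPre.symm x)).le
      rw [toL2_apply, toL2_apply, UniformSpace.Completion.norm_coe,
        UniformSpace.Completion.norm_coe] at this
      rw [one_mul]
      exact this).completion

@[simp]
lemma mulOp_toL2 (a b : A) : S.mulOp a (S.toL2 b) = S.toL2 (a * b) := by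
  rw [mulOp, toL2_apply, ContinuousLinearMap.completion_apply_coe]
  rfl

@[simp]
lemma actOp_toL2 (g : G) (b : A) : S.actOp g (S.toL2 b) = S.toL2 (S.act g b) := by
  rw [actOp, toL2_apply, ContinuousLinearMap.completion_apply_coe]
  rfl

lemma norm_mulOp_le (a : A) (x : S.L2) : ‖S.mulOp a x‖ ≤ ‖a‖ * ‖x‖ := by
  induction x using S.induction_toL2 with
  | hp => exact isClosed_le (by fun_prop) (by fun_prop)
  | h b => simpa using S.norm_toL2_mul_le a b

lemma norm_actOp (g : G) (x : S.L2) : ‖S.actOp g x‖ = ‖x‖ := by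
  induction x using S.induction_toL2 with
  | hp => exact isClosed_eq (by fun_prop) (by fun_prop)
  | h b => simpa using S.norm_toL2_act g b

lemma inner_mulOp_left (a : A) (x y : S.L2) :
    ⟪S.mulOp a x, y⟫_ℂ = ⟪x, S.mulOp (star a) y⟫_ℂ := by
  induction x using S.induction_toL2 with
  | hp => exact isClosed_eq (by fun_prop) (by fun_prop)
  | h b =>
    induction y using S.induction_toL2 with
    | hp => exact isClosed_eq (by fun_prop) (by fun_prop)
    | h c => simp only [mulOp_toL2, inner_toL2, star_mul]; ring_nf

lemma inner_actOp_left (g : G) (x y : S.L2) :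
    ⟪S.actOp g x, y⟫_ℂ = ⟪x, S.actOp g⁻¹ y⟫_ℂ := by
  induction x using S.induction_toL2 with
  | hp => exact isClosed_eq (by fun_prop) (by fun_prop)
  | h b =>
    induction y using S.induction_toL2 with
    | hp => exact isClosed_eq (by fun_prop) (by fun_prop)
    | h c =>
      simp only [actOp_toL2, inner_toL2]
      rw [← S.state_act g⁻¹ (star (S.act g b) * c), map_mul, map_star, act_inv_act]

end InvariantState

/-! ### The extended system on bounded sequences -/

open scoped InnerProductSpace BoundedContinuousFunction

namespace InvariantState

variable {G A : Type*} [Group G] [NormedCommRing A] [NormedAlgebra ℂ A] [StarRing A]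
  (S : InvariantState G A)

lemma norm_intervalAvg_state_le (b : ℤ →ᵇ A) (p : ℤ × ℕ) :
    ‖intervalAvg p fun k => S.state (b k)‖ ≤ ‖b‖ :=
  norm_intervalAvg_le p (norm_nonneg b)
    fun k => (S.norm_state_le _).trans (b.norm_coe_le_norm k)

lemma tendsto_intervalAvg_state (U : Ultrafilter (ℤ × ℕ)) (b : ℤ →ᵇ A) :
    Tendsto (fun p => intervalAvg p fun k => S.state (b k)) U
      (𝓝 (limUnder (U : Filter (ℤ × ℕ)) fun p => intervalAvg p fun k => S.state (b k))) :=
  U.tendsto_limUnder (S.norm_intervalAvg_state_le b)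

variable [NormedStarGroup A]

/-- The pointwise action on bounded sequences. -/
noncomputable def sequenceAct (g : G) : (ℤ →ᵇ A) →⋆ₐ[ℂ] (ℤ →ᵇ A) where
  toFun b := BoundedContinuousFunction.ofNormedAddCommGroupDiscrete (fun k => S.act g (b k)) ‖b‖
    fun k => (S.norm_act_le g _).trans (b.norm_coe_le_norm k)
  map_one' := by ext k; exact map_one (S.act g)
  map_mul' a b := by ext k; exact map_mul (S.act g) (a k) (b k)
  map_zero' := by ext k; exact map_zero (S.act g)
  map_add' a b := by ext k; exact map_add (S.act g) (a k) (b k)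
  commutes' c := by ext k; exact AlgHomClass.commutes (S.act g) c
  map_star' a := by ext k; exact map_star (S.act g) (a k)

lemma sequenceAct_apply (g : G) (b : ℤ →ᵇ A) (k : ℤ) : S.sequenceAct g b k = S.act g (b k) := rfl

/-- The invariant state on bounded sequences obtained by averaging over intervals and passing to
the limit along an ultrafilter. -/
noncomputable def sequenceState (U : Ultrafilter (ℤ × ℕ)) : InvariantState G (ℤ →ᵇ A) where
  state :=
    { toFun := fun b => limUnder (U : Filter (ℤ × ℕ)) fun p => intervalAvg p fun k => S.state (b k)
      map_add' := fun a b => by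
        refine Tendsto.limUnder_eq ?_
        simpa [intervalAvg_add] using
          (S.tendsto_intervalAvg_state U a).add (S.tendsto_intervalAvg_state U b)
      map_smul' := fun c b => by
        refine Tendsto.limUnder_eq ?_
        have := (S.tendsto_intervalAvg_state U b).const_smul c
        simpa only [← intervalAvg_smul, BoundedContinuousFunction.coe_smul, map_smul,
          RingHom.id_apply] using this }
  act :=
    { toFun := S.sequenceAct
      map_one' := by ext b k; rw [sequenceAct_apply, map_one]; rfl
      map_mul' := fun g h => by ext b k; rw [sequenceAct_apply, map_mul]; rfl }
  norm_act_le g b := (BoundedContinuousFunction.norm_le (norm_nonneg b)).2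
    fun k => (S.norm_act_le g _).trans (b.norm_coe_le_norm k)
  norm_state_le b := le_of_tendsto (S.tendsto_intervalAvg_state U b).norm
    (Eventually.of_forall (S.norm_intervalAvg_state_le b))
  state_act g b := by simp [sequenceAct_apply, S.state_act]
  state_star b := by
    refine Tendsto.limUnder_eq ?_
    refine ((continuous_star.tendsto _).comp (S.tendsto_intervalAvg_state U b)).congr fun p => ?_
    simp [intervalAvg, S.state_star]
  state_nonneg b := by
    refine ge_of_tendsto ((Complex.continuous_re.tendsto _).comp
      (S.tendsto_intervalAvg_state U (star b * b))) (Eventually.of_forall fun p => ?_)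
    simp only [Function.comp_apply, re_intervalAvg]
    exact mul_nonneg (by positivity) (Finset.sum_nonneg fun k _ => S.state_nonneg _)
  state_mul_le a b := by
    refine le_of_tendsto_of_tendsto ((Complex.continuous_re.tendsto _).comp
      (S.tendsto_intervalAvg_state U (star (a * b) * (a * b))))
      (((Complex.continuous_re.tendsto _).comp
        (S.tendsto_intervalAvg_state U (star b * b))).const_mul (‖a‖ ^ 2))
      (Eventually.of_forall fun p => ?_)
    simp only [Function.comp_apply, re_intervalAvg]
    rw [mul_left_comm (‖a‖ ^ 2), Finset.mul_sum _ _ (‖a‖ ^ 2)]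
    gcongr with k
    exact (S.state_mul_le (a _) (b _)).trans (mul_le_mul_of_nonneg_right
      (pow_le_pow_left₀ (norm_nonneg _) (a.norm_coe_le_norm _) 2) (S.state_nonneg _))

lemma sequenceState_act_apply (U : Ultrafilter (ℤ × ℕ)) (g : G) (b : ℤ →ᵇ A) (k : ℤ) :
    (S.sequenceState U).act g b k = S.act g (b k) := rfl

lemma tendsto_sequenceState (U : Ultrafilter (ℤ × ℕ)) (b : ℤ →ᵇ A) :
    Tendsto (fun p => intervalAvg p fun k => S.state (b k)) U
      (𝓝 ((S.sequenceState U).state b)) :=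
  S.tendsto_intervalAvg_state U b

end InvariantState

/-! ### Cauchy families, orbit products and averaging operators -/

/-- A family is Cauchy along a filter. -/
def CauchyAlong {ι E : Type*} [SeminormedAddCommGroup E] (L : Filter ι) (x : ι → E) : Prop :=
  Tendsto (fun q : ι × ι => ‖x q.1 - x q.2‖) (L ×ˢ L) (𝓝 0)

lemma CauchyAlong.of_le {ι E F : Type*} [SeminormedAddCommGroup E] [SeminormedAddCommGroup F]
    {L : Filter ι} {x : ι → E} {y : ι → F} (hx : CauchyAlong L x) (K : ℝ)
    (h : ∀ i j, ‖y i - y j‖ ≤ K * ‖x i - x j‖) : CauchyAlong L y :=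
  squeeze_zero (fun _ => norm_nonneg _) (fun _ => h _ _) (by simpa using hx.const_mul K)

section Lemmas

variable {E H ι : Type*} [SeminormedAddCommGroup E] [NormedSpace ℂ E]
  [NormedAddCommGroup H] [InnerProductSpace ℂ H]

lemma inner_intervalAvg_right (p : ℤ × ℕ) (x : H) (y : ℤ → H) :
    ⟪x, intervalAvg p y⟫_ℂ = intervalAvg p fun k => ⟪x, y k⟫_ℂ := by
  simp [intervalAvg]

lemma inner_intervalAvg_left (p : ℤ × ℕ) (x : H) (y : ℤ → H) :
    ⟪intervalAvg p y, x⟫_ℂ = intervalAvg p fun k => ⟪y k, x⟫_ℂ := by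
  simp [intervalAvg, mul_comm]

lemma tendsto_intervalAvg {l : Filter ι} (p : ℤ × ℕ) {y : ι → ℤ → E} {z : ℤ → E}
    (h : ∀ k, Tendsto (fun i => y i k) l (𝓝 (z k))) :
    Tendsto (fun i => intervalAvg p (y i)) l (𝓝 (intervalAvg p z)) :=
  (tendsto_finsetSum _ fun _ _ => h _).const_smul _

lemma norm_le_of_forall_norm_inner_le {y : H} {R : ℝ} (hR : 0 ≤ R)
    (h : ∀ x, ‖⟪y, x⟫_ℂ‖ ≤ R * ‖x‖) : ‖y‖ ≤ R := by
  rcases (norm_nonneg y).eq_or_lt' with h0 | h0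
  · rwa [h0]
  · have := h y
    rw [inner_self_eq_norm_sq_to_K] at this
    simp only [norm_pow, RCLike.norm_ofReal, abs_norm] at this
    nlinarith

end Lemmas

namespace InvariantState

variable {G A : Type*} [Group G] [NormedCommRing A] [NormedAlgebra ℂ A] [StarRing A]
  (S : InvariantState G A) {d : ℕ}

/-- The product of the translates `T i ^ j` of the `f i`. -/
noncomputable def orbitProd (T : Fin d → G) (f : Fin d → A) (j : ℤ) : A :=
  ∏ i, S.act (T i ^ j) (f i)

lemma exists_norm_orbitProd_le (T : Fin d → G) (f : Fin d → A) :
    ∃ C, 0 ≤ C ∧ ∀ j, ‖S.orbitProd T f j‖ ≤ C := by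
  unfold orbitProd
  induction (Finset.univ : Finset (Fin d)) using Finset.induction_on with
  | empty => exact ⟨‖(1 : A)‖, norm_nonneg _, fun j => by simp⟩
  | insert i s hi ih =>
    obtain ⟨C, hC, h⟩ := ih
    refine ⟨‖f i‖ * C, by positivity, fun j => ?_⟩
    rw [Finset.prod_insert hi]
    exact (norm_mul_le _ _).trans (mul_le_mul (S.norm_act_le _ _) (h j) (norm_nonneg _)
      (norm_nonneg _))

section NormedStar

variable [NormedStarGroup A]

/-- The bounded sequences which appear when the orbit products of `f` are correlated with their
translates. -/
noncomputable def correlationSeq (T : Fin d → G) (t : G) (f : Fin d → A) (i : Fin d) : ℤ →ᵇ A :=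
  BoundedContinuousFunction.ofNormedAddCommGroupDiscrete
    (fun k => f i * S.act (t ^ (-k) * T i ^ k) (star (f i))) (‖f i‖ * ‖f i‖) fun k => by
      refine (norm_mul_le _ _).trans ?_
      gcongr
      exact (S.norm_act_le _ _).trans (norm_star _).le

lemma correlationSeq_apply (T : Fin d → G) (t : G) (f : Fin d → A) (i : Fin d) (k : ℤ) :
    S.correlationSeq T t f i k = f i * S.act (t ^ (-k) * T i ^ k) (star (f i)) := rfl

/-- The factor `T_i^j` can be pulled out of `t^(-k) T_i^(k+j)` because `t` commutes with `T_i`. What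
remains depends on `k` only and is a sequence on which `T_i^j` acts pointwise. -/
lemma orbitProd_mul_act_star_orbitProd (U : Ultrafilter (ℤ × ℕ)) {T : Fin d → G} {t : G}
    (ht : ∀ i, Commute t (T i)) (f : Fin d → A) (j k : ℤ) :
    S.orbitProd T f j * S.act (t ^ (-k)) (star (S.orbitProd T f (k + j))) =
      (S.sequenceState U).orbitProd T (S.correlationSeq T t f) j k := by
  rw [orbitProd, orbitProd, orbitProd, BoundedContinuousFunction.prod_apply, star_prod, map_prod,
    ← Finset.prod_mul_distrib]
  refine Finset.prod_congr rfl fun i _ => ?_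
  rw [sequenceState_act_apply, correlationSeq_apply, map_mul, act_act, ← map_star, act_act]
  congr 3
  rw [← mul_assoc, ((ht i).zpow_zpow (-k) j).symm.eq, mul_assoc, ← zpow_add, add_comm]

end NormedStar

variable [StarModule ℂ A]

lemma exists_norm_toL2_le : ∃ C, 0 ≤ C ∧ ∀ a, ‖S.toL2 a‖ ≤ C * ‖a‖ :=
  ⟨‖S.toL2 1‖, norm_nonneg _, fun a => by simpa [mul_comm] using S.norm_toL2_mul_le a 1⟩

/-- The averages of the operators `x ↦ orbitProd T f j * t ^ j x`. -/
noncomputable def avgOp (T : Fin d → G) (t : G) (f : Fin d → A) (p : ℤ × ℕ) : S.L2 →L[ℂ] S.L2 :=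
  intervalAvg p fun j => S.mulOp (S.orbitProd T f j) ∘L S.actOp (t ^ j)

lemma avgOp_apply (T : Fin d → G) (t : G) (f : Fin d → A) (p : ℤ × ℕ) (x : S.L2) :
    S.avgOp T t f p x =
      intervalAvg p fun j => S.mulOp (S.orbitProd T f j) (S.actOp (t ^ j) x) := by
  simp [avgOp, intervalAvg]

lemma avgOp_toL2 (T : Fin d → G) (t : G) (f : Fin d → A) (p : ℤ × ℕ) (v : A) :
    S.avgOp T t f p (S.toL2 v) =
      S.toL2 (intervalAvg p fun j => S.orbitProd T f j * S.act (t ^ j) v) := by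
  simp [avgOp_apply, map_intervalAvg]

lemma exists_norm_avgOp_le (T : Fin d → G) (t : G) (f : Fin d → A) :
    ∃ C, 0 ≤ C ∧ ∀ p x, ‖S.avgOp T t f p x‖ ≤ C * ‖x‖ := by
  obtain ⟨C, hC, h⟩ := S.exists_norm_orbitProd_le T f
  refine ⟨C, hC, fun p x => ?_⟩
  rw [avgOp_apply]
  refine norm_intervalAvg_le p (by positivity) fun j => ?_
  refine (S.norm_mulOp_le _ _).trans ?_
  rw [norm_actOp]
  gcongr
  exact h j

/-- The vectors whose averages are Cauchy. -/
def cauchySubmodule (T : Fin d → G) (t : G) (f : Fin d → A) : Submodule ℂ S.L2 where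
  carrier := {x | CauchyAlong longIntervals fun p => S.avgOp T t f p x}
  zero_mem' := by simp [CauchyAlong]
  add_mem' {x y} hx hy := by
    refine squeeze_zero (fun _ => norm_nonneg _) (fun q => ?_) (by simpa using hx.add hy)
    simp only [map_add, add_sub_add_comm]
    exact norm_add_le _ _
  smul_mem' c x hx := by
    have := hx.const_mul ‖c‖
    rw [mul_zero] at this
    refine this.congr fun q => ?_
    simp only [map_smul, ← smul_sub, norm_smul]

/-- The operators `avgOp` are bounded uniformly in `p`, so the Cauchy property passes to norm
limits. -/
lemma isClosed_cauchySubmodule (T : Fin d → G) (t : G) (f : Fin d → A) :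
    IsClosed (S.cauchySubmodule T t f : Set S.L2) := by
  obtain ⟨C, hC, h⟩ := S.exists_norm_avgOp_le T t f
  refine isClosed_of_closure_subset fun x hx => ?_
  change Tendsto _ _ _
  rw [tendsto_order]
  refine ⟨fun a ha => Eventually.of_forall fun q => ha.trans_le (norm_nonneg _), fun ε hε => ?_⟩
  -- The two averages of `x - z` cost at most `2 * C * ‖x - z‖ < ε / 2`; the `+ 1` keeps the
  -- denominator positive when `C = 0`.
  obtain ⟨z, hz, hxz⟩ := Metric.mem_closure_iff.1 hx (ε / (2 * (2 * C + 1))) (by positivity)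
  have hz' : Tendsto _ _ _ := hz
  filter_upwards [hz'.eventually (gt_mem_nhds (half_pos hε))] with q hq
  have h1 := h q.1 (x - z)
  have h2 := h q.2 (x - z)
  rw [dist_eq_norm, lt_div_iff₀ (by positivity)] at hxz
  have e : S.avgOp T t f q.1 x - S.avgOp T t f q.2 x = S.avgOp T t f q.1 (x - z) -
      S.avgOp T t f q.2 (x - z) + (S.avgOp T t f q.1 z - S.avgOp T t f q.2 z) := by
    simp only [map_sub]; abel
  rw [e]
  refine (norm_add_le _ _).trans_lt ?_
  have := norm_sub_le (S.avgOp T t f q.1 (x - z)) (S.avgOp T t f q.2 (x - z))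
  nlinarith [norm_nonneg (x - z)]

/-- The adjoint averages, applied to an element of the algebra. -/
noncomputable def dualAvg (T : Fin d → G) (t : G) (f : Fin d → A) (p : ℤ × ℕ) (g : A) : S.L2 :=
  intervalAvg p fun k => S.toL2 (S.act (t ^ (-k)) (star (S.orbitProd T f k) * g))

lemma inner_dualAvg (T : Fin d → G) (t : G) (f : Fin d → A) (p : ℤ × ℕ) (g : A) (x : S.L2) :
    ⟪S.dualAvg T t f p g, x⟫_ℂ = ⟪S.toL2 g, S.avgOp T t f p x⟫_ℂ := by
  rw [dualAvg, avgOp_apply, inner_intervalAvg_left, inner_intervalAvg_right]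
  congr 1
  funext k
  rw [← actOp_toL2, ← mulOp_toL2, inner_actOp_left, inner_mulOp_left, star_star, zpow_neg, inv_inv]

variable [NormedStarGroup A]

lemma exists_norm_dualAvg_le (T : Fin d → G) (t : G) (f : Fin d → A) :
    ∃ C, 0 ≤ C ∧ ∀ p g, ‖S.dualAvg T t f p g‖ ≤ C * ‖g‖ := by
  obtain ⟨C, hC, h⟩ := S.exists_norm_orbitProd_le T f
  obtain ⟨D, hD, h'⟩ := S.exists_norm_toL2_le
  refine ⟨D * C, by positivity, fun p g => norm_intervalAvg_le p (by positivity) fun k => ?_⟩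
  rw [norm_toL2_act, mul_assoc]
  refine (h' _).trans (mul_le_mul_of_nonneg_left ((norm_mul_le _ _).trans ?_) hD)
  rw [norm_star]
  gcongr
  exact h k

/-- Applying the `j`-th operator to the adjoint average puts `t^(j-k)` inside. Replacing `k` by `k +
j` is negligible on long intervals and cancels `j`, so that only the correlation sequences carry it.
-/
lemma tendsto_mulOp_actOp_dualAvg_sub (U : Ultrafilter (ℤ × ℕ))
    {T : Fin d → G} {t : G} (ht : ∀ i, Commute t (T i)) (f : Fin d → A) {g : ℤ × ℕ → A} {K : ℝ}
    (hg : ∀ p, ‖g p‖ ≤ K) (j : ℤ) :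
    Tendsto (fun p => S.mulOp (S.orbitProd T f j) (S.actOp (t ^ j) (S.dualAvg T t f p (g p))) -
      S.toL2 (intervalAvg p fun k =>
        (S.sequenceState U).orbitProd T (S.correlationSeq T t f) j k * S.act (t ^ (-k)) (g p)))
      longIntervals (𝓝 0) := by
  obtain ⟨C, hC, h⟩ := S.exists_norm_orbitProd_le T f
  obtain ⟨D, hD, h'⟩ := S.exists_norm_toL2_le
  have hb (p : ℤ × ℕ) (k : ℤ) : ‖S.toL2 (S.orbitProd T f j *
      S.act (t ^ (j - k)) (star (S.orbitProd T f k) * g p))‖ ≤ D * (C * (C * K)) := by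
    refine (h' _).trans (mul_le_mul_of_nonneg_left ((norm_mul_le _ _).trans ?_) hD)
    refine mul_le_mul (h j) ((S.norm_act_le _ _).trans ((norm_mul_le _ _).trans ?_))
      (norm_nonneg _) hC
    rw [norm_star]
    exact mul_le_mul (h k) (hg p) (norm_nonneg _) hC
  refine (tendsto_intervalAvg_sub_shift hb j).congr fun p => ?_
  congr 1
  · rw [dualAvg, map_intervalAvg, map_intervalAvg]
    simp only [actOp_toL2, mulOp_toL2, act_act, ← zpow_add, sub_eq_add_neg]
  · rw [map_intervalAvg]
    congr 1
    funext k
    rw [← S.orbitProd_mul_act_star_orbitProd U ht, mul_assoc, ← map_mul]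
    congr 5
    ring

end InvariantState

/-! ### The inductive step and convergence in invariant states -/

namespace InvariantState

variable {G A : Type*} [Group G] [NormedCommRing A] [NormedAlgebra ℂ A] [StarRing A]
  (S : InvariantState G A) {d : ℕ} [StarModule ℂ A] [NormedStarGroup A]

/-- Cauchy-Schwarz for averages of products with bounded sequences, in terms of the limit state. -/
lemma exists_bound_tendsto_sequenceState (U : Ultrafilter (ℤ × ℕ)) (t : G) (c : ℤ →ᵇ A)
    {g : ℤ × ℕ → A} {K : ℝ} (hK : 0 ≤ K) (hg : ∀ p, ‖g p‖ ≤ K) :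
    ∃ r : ℤ × ℕ → ℝ, (∀ p, ‖S.toL2 (intervalAvg p fun k => c k * S.act (t ^ (-k)) (g p))‖ ≤ r p) ∧
      Tendsto r U (𝓝 (K * ‖(S.sequenceState U).toL2 c‖)) := by
  -- The mean of the `S.state (star c * c)` tends along `U` to the squared norm of `c` for the limit
  -- state; `K ^ 2` pays for the translates of `g p`.
  refine ⟨fun p => √(K ^ 2 * (intervalAvg p fun k => S.state ((star c * c) k)).re), fun p => ?_, ?_⟩
  · refine Real.le_sqrt_of_sq_le ?_
    rw [map_intervalAvg, re_intervalAvg, mul_left_comm, Finset.mul_sum]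
    refine (norm_intervalAvg_sq_le _ _).trans ?_
    gcongr with k
    have h : ‖S.toL2 (c (p.1 + k) * S.act (t ^ (-(p.1 + k))) (g p))‖ ≤
        K * ‖S.toL2 (c (p.1 + k))‖ := by
      rw [mul_comm]
      refine (S.norm_toL2_mul_le _ _).trans ?_
      gcongr
      exact (S.norm_act_le _ _).trans (hg p)
    calc _ ≤ (K * ‖S.toL2 (c (p.1 + k))‖) ^ 2 := by gcongr
      _ = _ := by rw [mul_pow, norm_sq_toL2]; rfl
  · have h := (((Complex.continuous_re.tendsto _).comp
      (S.tendsto_sequenceState U (star c * c))).const_mul (K ^ 2)).sqrt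
    rw [← norm_sq_toL2, ← mul_pow, Real.sqrt_sq (by positivity)] at h
    exact h

/-- This reduces `σ` to the inductive hypothesis: `avgOp q σ` is a weak limit of averages whose
coefficients are the `q`-average of the orbit product in the extended system, and Cauchy–Schwarz
bounds differences of these. -/
lemma norm_avgOp_sub_le_of_weak_limit {U : Ultrafilter (ℤ × ℕ)}
    (hU : (U : Filter (ℤ × ℕ)) ≤ longIntervals) {T : Fin d → G} {t : G}
    (ht : ∀ i, Commute t (T i)) (f : Fin d → A) {g : ℤ × ℕ → A} {K : ℝ} (hK : 0 ≤ K)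
    (hg : ∀ p, ‖g p‖ ≤ K) {σ : S.L2}
    (hσ : ∀ x, Tendsto (fun p => ⟪S.dualAvg T t f p (g p), x⟫_ℂ) U (𝓝 ⟪σ, x⟫_ℂ)) (q q' : ℤ × ℕ) :
    ‖S.avgOp T t f q σ - S.avgOp T t f q' σ‖ ≤ K *
      ‖(S.sequenceState U).toL2
          (intervalAvg q ((S.sequenceState U).orbitProd T (S.correlationSeq T t f))) -
        (S.sequenceState U).toL2
          (intervalAvg q' ((S.sequenceState U).orbitProd T (S.correlationSeq T t f)))‖ := by
  set Φ := (S.sequenceState U).orbitProd T (S.correlationSeq T t f)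
  have key (h : S.L2) (q : ℤ × ℕ) : Tendsto (fun p => ⟪S.toL2 (intervalAvg p fun k =>
      (intervalAvg q Φ) k * S.act (t ^ (-k)) (g p)), h⟫_ℂ) U (𝓝 ⟪S.avgOp T t f q σ, h⟫_ℂ) := by
    have h1 (j : ℤ) : Tendsto (fun p => ⟪S.toL2 (intervalAvg p fun k =>
        Φ j k * S.act (t ^ (-k)) (g p)), h⟫_ℂ) U
        (𝓝 ⟪S.mulOp (S.orbitProd T f j) (S.actOp (t ^ j) σ), h⟫_ℂ) := by
      have e1 : Tendsto (fun p => ⟪S.mulOp (S.orbitProd T f j) (S.actOp (t ^ j)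
          (S.dualAvg T t f p (g p))), h⟫_ℂ) U
          (𝓝 ⟪S.mulOp (S.orbitProd T f j) (S.actOp (t ^ j) σ), h⟫_ℂ) := by
        simp only [inner_mulOp_left, inner_actOp_left]
        exact hσ _
      have e2 := ((S.tendsto_mulOp_actOp_dualAvg_sub U ht f hg j).mono_left hU).inner
        (tendsto_const_nhds (x := h)) (𝕜 := ℂ)
      have e3 := e1.sub e2
      rw [inner_zero_left, sub_zero] at e3
      refine e3.congr fun p => ?_
      rw [← inner_sub_left, sub_sub_cancel]
    rw [avgOp_apply, inner_intervalAvg_left]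
    -- With `q` fixed, a finite average commutes with the limit and with the average over `p`.
    refine (tendsto_intervalAvg q h1).congr fun p => ?_
    rw [← inner_intervalAvg_left, ← map_intervalAvg, intervalAvg_comm]
    congr 3
    funext k
    simp [intervalAvg, Finset.sum_mul]
  obtain ⟨r, hr, hr'⟩ := S.exists_bound_tendsto_sequenceState U t
    (intervalAvg q Φ - intervalAvg q' Φ) hK hg
  rw [← map_sub]
  refine norm_le_of_forall_norm_inner_le (by positivity) fun h => ?_
  rw [inner_sub_left]
  refine le_of_tendsto_of_tendsto ((key h q).sub (key h q')).norm (hr'.mul_const ‖h‖)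
    (Eventually.of_forall fun p => ?_)
  beta_reduce
  rw [← inner_sub_left, ← map_sub, ← intervalAvg_sub]
  refine (norm_inner_le_norm _ _).trans ?_
  gcongr
  refine le_trans (le_of_eq ?_) (hr p)
  simp only [BoundedContinuousFunction.coe_sub, Pi.sub_apply, sub_mul]

/-- If all correlation averages converge, then vectors orthogonal to those with Cauchy averages
have averages tending to zero. -/
lemma tendsto_avgOp_of_mem_orthogonal {T : Fin d → G} {t : G} (ht : ∀ i, Commute t (T i))
    (f : Fin d → A)
    (ih : ∀ U : Ultrafilter (ℤ × ℕ), ∀ φ : Fin d → (ℤ →ᵇ A), CauchyAlong longIntervals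
      fun p => (S.sequenceState U).toL2 (intervalAvg p ((S.sequenceState U).orbitProd T φ)))
    {u : S.L2} (hu : u ∈ (S.cauchySubmodule T t f)ᗮ) :
    Tendsto (fun p => S.avgOp T t f p u) longIntervals (𝓝 0) := by
  rw [tendsto_iff_ultrafilter]
  intro U hU
  obtain ⟨C, hC, hC'⟩ := S.exists_norm_avgOp_le T t f
  obtain ⟨D, hD, hD'⟩ := S.exists_norm_dualAvg_le T t f
  obtain ⟨M, hM, hM'⟩ := S.exists_norm_orbitProd_le T f
  have hsq : Tendsto (fun p => ‖S.avgOp T t f p u‖ ^ 2) U (𝓝 0) := by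
    rw [tendsto_order]
    refine ⟨fun a ha => Eventually.of_forall fun p => ha.trans_le (by positivity), fun ε hε => ?_⟩
    -- Replacing `u` by `v` in one factor of `‖avgOp u‖ ^ 2` costs `C * ‖u - v‖ * (C * ‖u‖) < ε /
    -- 2`.
    obtain ⟨v, hv⟩ : ∃ v, ‖u - S.toL2 v‖ * (2 * (C * (C * ‖u‖) + 1)) < ε := by
      obtain ⟨v, hv⟩ := Metric.denseRange_iff.1 S.denseRange_toL2 u
        (ε / (2 * (C * (C * ‖u‖) + 1))) (by positivity)
      rw [dist_eq_norm, lt_div_iff₀ (by positivity)] at hv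
      exact ⟨v, hv⟩
    -- This is `avgOp` at `v` before passing to the Hilbert space; taking `v` in the algebra gives
    -- the norm bound uniform in `p`.
    set g : ℤ × ℕ → A := fun p => intervalAvg p fun j => S.orbitProd T f j * S.act (t ^ j) v
    have hg (p : ℤ × ℕ) : ‖g p‖ ≤ M * ‖v‖ := by
      refine norm_intervalAvg_le p (by positivity) fun j => (norm_mul_le _ _).trans ?_
      gcongr
      · exact hM' j
      · exact S.norm_act_le _ _
    obtain ⟨σ, hσ⟩ := U.exists_weak_limit (σ := fun p => S.dualAvg T t f p (g p))
      (C := D * (M * ‖v‖)) fun p => (hD' _ _).trans (by gcongr; exact hg p)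
    have hσC : σ ∈ S.cauchySubmodule T t f :=
      CauchyAlong.of_le (ih U (S.correlationSeq T t f)) (M * ‖v‖)
        (S.norm_avgOp_sub_le_of_weak_limit hU ht f (by positivity) hg hσ)
    have h0 := hσ u
    rw [Submodule.inner_right_of_mem_orthogonal hσC hu] at h0
    have h0' := h0.norm
    rw [norm_zero] at h0'
    filter_upwards [h0'.eventually (gt_mem_nhds (half_pos hε))] with p hp
    rw [inner_dualAvg, ← avgOp_toL2] at hp
    have e : ‖S.avgOp T t f p u‖ ^ 2 = ‖⟪S.avgOp T t f p u, S.avgOp T t f p u⟫_ℂ‖ := by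
      rw [inner_self_eq_norm_sq_to_K]; simp
    have e' : ⟪S.avgOp T t f p u, S.avgOp T t f p u⟫_ℂ =
        ⟪S.avgOp T t f p (S.toL2 v), S.avgOp T t f p u⟫_ℂ +
        ⟪S.avgOp T t f p (u - S.toL2 v), S.avgOp T t f p u⟫_ℂ := by
      rw [← inner_add_left, ← map_add, add_sub_cancel]
    rw [e, e']
    refine (norm_add_le _ _).trans_lt ?_
    have h2 : ‖⟪S.avgOp T t f p (u - S.toL2 v), S.avgOp T t f p u⟫_ℂ‖ ≤
        (C * ‖u - S.toL2 v‖) * (C * ‖u‖) :=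
      (norm_inner_le_norm _ _).trans (mul_le_mul (hC' _ _) (hC' _ _) (norm_nonneg _)
        (by positivity))
    nlinarith [norm_nonneg (u - S.toL2 v)]
  refine tendsto_zero_iff_norm_tendsto_zero.2 ?_
  simpa [Real.sqrt_sq] using hsq.sqrt

/-- A vector orthogonal to the subspace has averages tending to zero, so it belongs to the subspace
and is orthogonal to itself. -/
lemma cauchySubmodule_eq_top {T : Fin d → G} {t : G} (ht : ∀ i, Commute t (T i))
    (f : Fin d → A)
    (ih : ∀ U : Ultrafilter (ℤ × ℕ), ∀ φ : Fin d → (ℤ →ᵇ A), CauchyAlong longIntervals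
      fun p => (S.sequenceState U).toL2 (intervalAvg p ((S.sequenceState U).orbitProd T φ))) :
    S.cauchySubmodule T t f = ⊤ := by
  have : CompleteSpace (S.cauchySubmodule T t f) :=
    (S.isClosed_cauchySubmodule T t f).completeSpace_coe
  rw [← Submodule.orthogonal_eq_bot_iff, Submodule.eq_bot_iff]
  intro u hu
  have h0 := S.tendsto_avgOp_of_mem_orthogonal ht f ih hu
  have hu' : u ∈ S.cauchySubmodule T t f := by
    have := ((h0.comp (tendsto_fst (g := longIntervals))).sub (h0.comp tendsto_snd)).norm
    rw [sub_zero, norm_zero] at this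
    exact this
  exact inner_self_eq_zero.1 (Submodule.inner_right_of_mem_orthogonal hu' hu)

/-- Averages of products of translates by commuting elements are Cauchy. -/
theorem cauchyAlong_orbitProd (T : Fin d → G) (hT : ∀ i j, Commute (T i) (T j))
    (f : Fin d → A) :
    CauchyAlong longIntervals fun p => S.toL2 (intervalAvg p (S.orbitProd T f)) := by
  -- The algebra must vary, since the inductive hypothesis is used for `ℤ →ᵇ A`.
  induction d generalizing A with
  | zero =>
    have h : ∀ᶠ p in longIntervals, S.toL2 (intervalAvg p (S.orbitProd T f)) = S.toL2 1 := by
      filter_upwards [tendsto_snd_longIntervals.eventually_ne_atTop 0] with p hp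
      have : S.orbitProd T f = fun _ => 1 := by funext j; simp [orbitProd]
      rw [this, intervalAvg_const p hp]
    refine (tendsto_const_nhds (x := (0 : ℝ))).congr' ?_
    filter_upwards [h.prod_mk h] with q hq
    rw [hq.1, hq.2, sub_self, norm_zero]
  | succ d ih =>
    -- The last transformation plays the role of `t`, and the last function becomes the vector being
    -- averaged.
    have h := S.cauchySubmodule_eq_top (T := fun i => T i.castSucc) (t := T (Fin.last d))
      (fun i => hT _ _) (fun i => f i.castSucc)
      (fun U φ => ih (S.sequenceState U) _ (fun i j => hT _ _) φ)
    have hx : S.toL2 (f (Fin.last d)) ∈ S.cauchySubmodule (fun i => T i.castSucc) (T (Fin.last d))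
        fun i => f i.castSucc := h ▸ Submodule.mem_top
    have hx' : CauchyAlong longIntervals fun p => S.avgOp (fun i => T i.castSucc) (T (Fin.last d))
        (fun i => f i.castSucc) p (S.toL2 (f (Fin.last d))) := hx
    simp only [avgOp_toL2] at hx'
    convert hx' using 5
    simp [orbitProd, Fin.prod_univ_castSucc]

end InvariantState

/-! ### The invariant state of a probability space -/

section BoundedMeasurable

variable {X : Type*} [MeasurableSpace X]

/-- The algebra of bounded measurable complex functions, with the supremum norm. -/
noncomputable def boundedMeasurable (X : Type*) [MeasurableSpace X] :
    StarSubalgebra ℂ (lp (fun _ : X => ℂ) ∞) where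
  carrier := {a | Measurable (a : X → ℂ)}
  mul_mem' {a b} ha hb := by
    change Measurable _
    rw [lp.infty_coeFn_mul]
    exact ha.mul hb
  add_mem' {a b} ha hb := by
    change Measurable _
    rw [lp.coeFn_add]
    exact ha.add hb
  algebraMap_mem' c := measurable_const (a := c)
  star_mem' {a} ha := by
    change Measurable _
    rw [lp.coeFn_star]
    exact continuous_star.measurable.comp ha

/-- The bounded measurable complex functions. -/
abbrev BoundedMeasurable (X : Type*) [MeasurableSpace X] : Type _ := ↥(boundedMeasurable X)

noncomputable instance : CoeFun (BoundedMeasurable X) fun _ => X → ℂ := ⟨fun a => a.1⟩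

instance : NormedStarGroup (BoundedMeasurable X) where
  norm_star_le a := (norm_star (a : lp (fun _ : X => ℂ) ∞)).le

namespace BoundedMeasurable

lemma measurable (a : BoundedMeasurable X) : Measurable a := a.2

lemma norm_apply_le (a : BoundedMeasurable X) (x : X) : ‖a x‖ ≤ ‖a‖ :=
  lp.norm_apply_le_norm ENNReal.top_ne_zero a.1 x

@[ext]
lemma ext {a b : BoundedMeasurable X} (h : ∀ x, a x = b x) : a = b :=
  Subtype.ext (lp.ext (funext h))

/-- Evaluation at a point. -/
noncomputable def eval (x : X) : BoundedMeasurable X →ₐ[ℂ] ℂ where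
  toFun a := a x
  map_one' := rfl
  map_mul' _ _ := rfl
  map_zero' := rfl
  map_add' _ _ := rfl
  commutes' _ := rfl

lemma eval_apply (x : X) (a : BoundedMeasurable X) : eval x a = a x := rfl

lemma intervalAvg_apply (p : ℤ × ℕ) (u : ℤ → BoundedMeasurable X) (x : X) :
    intervalAvg p u x = intervalAvg p fun k => u k x :=
  map_intervalAvg (eval x).toLinearMap p u

/-- A bounded measurable function from a bound. -/
noncomputable def ofBound (f : X → ℂ) (hf : Measurable f) (C : ℝ) (hC : ∀ x, ‖f x‖ ≤ C) :
    BoundedMeasurable X :=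
  ⟨⟨f, memℓp_infty ⟨C, by rintro _ ⟨x, rfl⟩; exact hC x⟩⟩, hf⟩

lemma ofBound_apply (f : X → ℂ) (hf : Measurable f) (C : ℝ) (hC : ∀ x, ‖f x‖ ≤ C) (x : X) :
    ofBound f hf C hC x = f x := rfl

/-- Composition with a measurable map. -/
noncomputable def compHom (φ : X → X) (hφ : Measurable φ) :
    BoundedMeasurable X →⋆ₐ[ℂ] BoundedMeasurable X where
  toFun a := ofBound (fun x => a (φ x)) (a.measurable.comp hφ) ‖a‖ fun x => a.norm_apply_le (φ x)
  map_one' := rfl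
  map_mul' _ _ := rfl
  map_zero' := rfl
  map_add' _ _ := rfl
  commutes' _ := rfl
  map_star' _ := rfl

variable (μ : Measure X) [IsProbabilityMeasure μ]

lemma integrable (a : BoundedMeasurable X) : Integrable a μ :=
  Integrable.of_bound a.measurable.aestronglyMeasurable ‖a‖
    (Eventually.of_forall fun x => a.norm_apply_le x)

lemma memLp (a : BoundedMeasurable X) (p : ℝ≥0∞) : MemLp a p μ :=
  MemLp.of_bound a.measurable.aestronglyMeasurable ‖a‖
    (Eventually.of_forall fun x => a.norm_apply_le x)

lemma re_integral_star_mul_self (a : BoundedMeasurable X) :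
    (∫ x, (star a * a) x ∂μ).re = ∫ x, ‖a x‖ ^ 2 ∂μ := by
  have h := integral_re ((star a * a).integrable μ)
  refine h.symm.trans (integral_congr_ae (Eventually.of_forall fun x => ?_))
  change (star (a x) * a x).re = ‖a x‖ ^ 2
  rw [Complex.star_def, Complex.conj_mul', ← Complex.ofReal_pow, Complex.ofReal_re]

omit [IsProbabilityMeasure μ] in
-- A measurable representative is set to zero where it exceeds the essential supremum, which happens
-- only on a null set.
lemma exists_ae_eq {f : X → ℂ} (hf : MemLp f ∞ μ) :
    ∃ a : BoundedMeasurable X, f =ᵐ[μ] a := by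
  obtain ⟨hm, hb⟩ := hf
  set g := hm.mk f
  have hg : Measurable g := hm.stronglyMeasurable_mk.measurable
  set C := (eLpNorm f ∞ μ).toReal
  have hC : 0 ≤ C := ENNReal.toReal_nonneg
  have hs : MeasurableSet {x | ‖g x‖ ≤ C} := measurableSet_le hg.norm measurable_const
  refine ⟨ofBound ({x | ‖g x‖ ≤ C}.indicator g) (hg.indicator hs) C fun x => ?_, ?_⟩
  · by_cases hx : x ∈ {x | ‖g x‖ ≤ C}
    · rwa [Set.indicator_of_mem hx]
    · rw [Set.indicator_of_notMem hx, norm_zero]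
      exact hC
  · have hbd : ∀ᵐ x ∂μ, ‖f x‖ ≤ C := by
      filter_upwards [ae_le_eLpNormEssSup (f := f) (μ := μ)] with x hx
      rw [← eLpNorm_exponent_top] at hx
      simpa only [toReal_enorm] using ENNReal.toReal_mono hb.ne hx
    filter_upwards [hm.ae_eq_mk, hbd] with x hx hx'
    have hx'' : x ∈ {x | ‖g x‖ ≤ C} := by
      change ‖g x‖ ≤ C
      rwa [hx] at hx'
    rw [ofBound_apply, Set.indicator_of_mem hx'', hx]

end BoundedMeasurable

/-- The group of bimeasurable measure-preserving bijections. -/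
def measurePreservingPerm (μ : Measure X) : Subgroup (Equiv.Perm X) where
  carrier := {σ | MeasurePreserving σ μ μ ∧ MeasurePreserving (σ⁻¹ : Equiv.Perm X) μ μ}
  one_mem' := ⟨MeasurePreserving.id μ, MeasurePreserving.id μ⟩
  mul_mem' {σ τ} hσ hτ := ⟨hσ.1.comp hτ.1, by
    rw [mul_inv_rev]
    exact hτ.2.comp hσ.2⟩
  inv_mem' {σ} hσ := ⟨hσ.2, by rw [inv_inv]; exact hσ.1⟩

/-- The invariant state given by a probability measure. -/
noncomputable def integralState (μ : Measure X) [IsProbabilityMeasure μ] :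
    InvariantState (measurePreservingPerm μ) (BoundedMeasurable X) where
  state :=
    { toFun := fun a => ∫ x, a x ∂μ
      map_add' := fun a b => integral_add (a.integrable μ) (b.integrable μ)
      map_smul' := fun c a => integral_const_mul c a }
  act :=
    -- Composition with the inverse of `σ` makes this a homomorphism and not an antihomomorphism.
    { toFun := fun σ => BoundedMeasurable.compHom _ σ.2.2.measurable
      map_one' := by ext a x; rfl
      map_mul' := fun σ τ => by
        ext a x
        change a _ = a _
        congr 1 }
  norm_act_le σ a := lp.norm_le_of_forall_le (norm_nonneg a) fun x => a.norm_apply_le _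
  norm_state_le a := by
    refine (norm_integral_le_of_norm_le_const (μ := μ) (C := ‖a‖)
      (Eventually.of_forall fun x => a.norm_apply_le x)).trans (le_of_eq ?_)
    simp
  state_act σ a := by
    change ∫ x, a ((σ⁻¹ : Equiv.Perm X) x) ∂μ = ∫ x, a x ∂μ
    rw [← integral_map σ.2.2.measurable.aemeasurable a.measurable.aestronglyMeasurable,
      σ.2.2.map_eq]
  state_star a := integral_conj (f := a)
  state_nonneg a := by
    refine le_of_le_of_eq ?_ (a.re_integral_star_mul_self μ).symm
    positivity
  state_mul_le a b := by
    refine ((a * b).re_integral_star_mul_self μ).le.trans (le_of_le_of_eq ?_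
      (congrArg (‖a‖ ^ 2 * ·) (b.re_integral_star_mul_self μ).symm))
    rw [← integral_const_mul]
    refine integral_mono ((a * b).memLp μ 2).integrable_norm_pow'
      (((b.memLp μ 2).integrable_norm_pow').const_mul _) fun x => ?_
    change ‖a x * b x‖ ^ 2 ≤ _
    rw [norm_mul, mul_pow]
    gcongr
    exact a.norm_apply_le x

variable (μ : Measure X) [IsProbabilityMeasure μ]

/-- Equality of norms is enough to move Cauchy families from the abstract Hilbert space to `Lp`; the
two spaces need not be identified. -/
lemma norm_toLp_boundedMeasurable (a : BoundedMeasurable X) :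
    ‖(a.memLp μ 2).toLp a‖ = ‖(integralState μ).toL2 a‖ := by
  rw [← sq_eq_sq₀ (norm_nonneg _) (norm_nonneg _), InvariantState.norm_sq_toL2]
  refine Eq.trans ?_ (a.re_integral_star_mul_self μ).symm
  rw [← inner_self_eq_norm_sq (𝕜 := ℂ), L2.inner_def, ← integral_re (L2.integrable_inner _ _)]
  refine integral_congr_ae ?_
  filter_upwards [(a.memLp μ 2).coeFn_toLp] with x hx
  rw [hx, inner_self_eq_norm_sq]

lemma sum_Icc_int (a b : ℤ) (u : ℤ → ℂ) :
    ∑ n ∈ Finset.Icc a b, u n = ∑ k ∈ Finset.range (Finset.Icc a b).card, u (a + k) := by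
  rw [Int.card_Icc]
  refine (Finset.sum_nbij' (fun k : ℕ => a + (k : ℤ)) (fun n => (n - a).toNat) ?_ ?_ ?_ ?_ ?_).symm
  all_goals intro k hk; simp only [Finset.mem_range, Finset.mem_Icc] at *
  all_goals omega

/-- The multiple ergodic averages are represented by averages in the algebra of bounded measurable
functions. -/
lemma multipleErgodicAverage_ae_eq {d : ℕ} (T : Fin d → X ≃ᵐ X)
    (T' : Fin d → measurePreservingPerm μ) (hT' : ∀ i, (T' i : Equiv.Perm X) = (T i).toEquiv)
    {f : Fin d → X → ℂ} {a : Fin d → BoundedMeasurable X} (hfa : ∀ i, f i =ᵐ[μ] a i) (l m : ℤ) :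
    multipleErgodicAverage T f (Finset.Icc l m) =ᵐ[μ]
      (intervalAvg (l, (Finset.Icc l m).card)
        ((integralState μ).orbitProd (fun i => (T' i)⁻¹) a) : BoundedMeasurable X) := by
  -- There are countably many pairs `(n, i)`, and each power preserves null sets.
  have h : ∀ᵐ x ∂μ, ∀ n : ℤ, ∀ i, f i ((((T i).toEquiv : Equiv.Perm X) ^ n) x) =
      a i ((((T i).toEquiv : Equiv.Perm X) ^ n) x) := by
    rw [ae_all_iff]
    intro n
    rw [ae_all_iff]
    intro i
    have hp : MeasurePreserving (((T i).toEquiv : Equiv.Perm X) ^ n) μ μ := by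
      rw [← hT' i]
      exact (T' i ^ n).2.1
    exact hp.quasiMeasurePreserving.ae (hfa i)
  filter_upwards [h] with x hx
  rw [BoundedMeasurable.intervalAvg_apply, multipleErgodicAverage, sum_Icc_int,
    intervalAvg, smul_eq_mul]
  congr 1
  refine Finset.sum_congr rfl fun k _ => ?_
  rw [InvariantState.orbitProd, ← BoundedMeasurable.eval_apply, map_prod]
  refine Finset.prod_congr rfl fun i _ => ?_
  -- The inverse in the action cancels the one in `(T' i)⁻¹`, leaving composition with `T i ^ n`.
  rw [hx, ← hT' i, inv_zpow, BoundedMeasurable.eval_apply]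
  change _ = a i (((((T' i ^ (l + (k : ℤ)))⁻¹)⁻¹ : measurePreservingPerm μ) : Equiv.Perm X) x)
  rw [inv_inv]
  rfl

lemma exists_tendsto_of_cauchyAlong {ι E : Type*} [NormedAddCommGroup E] [CompleteSpace E]
    {L : Filter ι} [L.NeBot] {x : ι → E} (h : CauchyAlong L x) : ∃ y, Tendsto x L (𝓝 y) := by
  rw [← cauchy_map_iff_exists_tendsto, cauchy_map_iff]
  refine ⟨inferInstance, tendsto_uniformity_iff_dist_tendsto_zero.2 ?_⟩
  simp only [dist_eq_norm]
  exact h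

end BoundedMeasurable

/-! ### Norm convergence for commuting transformations -/

theorem theoremC {X : Type*} [MeasurableSpace X] (μ : Measure X) [IsProbabilityMeasure μ]
    (d : ℕ) (T : Fin d → X ≃ᵐ X)
    (hT : ∀ i, MeasurePreserving (T i) μ μ)
    (hcomm : ∀ i j x, T i (T j x) = T j (T i x))
    (f : Fin d → X → ℂ) (hf : ∀ i, MemLp (f i) ∞ μ) :
    ∃ F : X → ℂ, MemLp F 2 μ ∧
      ∀ I : ℕ → Finset ℤ, (∀ N, ∃ a b : ℤ, I N = Finset.Icc a b) →
        Tendsto (fun N => (I N).card) atTop atTop →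
        (∀ N, MemLp (multipleErgodicAverage T f (I N)) 2 μ) ∧
        Tendsto (fun N => eLpNorm (multipleErgodicAverage T f (I N) - F) 2 μ) atTop (𝓝 0) := by
  choose a ha using fun i => BoundedMeasurable.exists_ae_eq μ (hf i)
  let T' (i : Fin d) : measurePreservingPerm μ := ⟨(T i).toEquiv, hT i, (hT i).symm (T i)⟩
  have hT' (i j : Fin d) : Commute (T' i)⁻¹ (T' j)⁻¹ :=
    Commute.inv_inv (Subtype.ext (Equiv.ext fun x => hcomm i j x))
  set A : ℤ × ℕ → BoundedMeasurable X := fun p =>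
    intervalAvg p ((integralState μ).orbitProd (fun i => (T' i)⁻¹) a)
  have hc : CauchyAlong longIntervals fun p => ((A p).memLp μ 2).toLp (A p) := by
    refine ((integralState μ).cauchyAlong_orbitProd _ hT' a).of_le 1 fun p q => ?_
    rw [one_mul, ← map_sub, ← norm_toLp_boundedMeasurable, ← MemLp.toLp_sub]
    rfl
  obtain ⟨F, hF⟩ := exists_tendsto_of_cauchyAlong hc
  refine ⟨F, Lp.memLp F, fun I hI hcard => ?_⟩
  choose l m hlm using hI
  have hae (N : ℕ) : multipleErgodicAverage T f (I N) =ᵐ[μ] A (l N, (I N).card) := by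
    rw [hlm N]
    exact multipleErgodicAverage_ae_eq μ T T' (fun _ => rfl) ha (l N) (m N)
  refine ⟨fun N => (memLp_congr_ae (hae N)).2 ((A _).memLp μ 2), ?_⟩
  -- The filter does not constrain the left end points, so growing length suffices.
  have hp : Tendsto (fun N => (l N, (I N).card)) atTop longIntervals :=
    tendsto_top.prodMk hcard
  refine ((Lp.tendsto_Lp_iff_tendsto_eLpNorm' _ _).1 (hF.comp hp)).congr fun N => ?_
  refine eLpNorm_congr_ae ?_
  filter_upwards [hae N, ((A (l N, (I N).card)).memLp μ 2).coeFn_toLp] with x h1 h2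
  simp only [Pi.sub_apply, Function.comp_apply, h1, h2]
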